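/- Let $n\ge 1$, let $N$ be a prime, and let $B\in\mathbb{Z}^{n\times n}$ be a matrix in systematic normal form (SNF): $B_{1,1}=N$, $B_{i,i}=1$ for $i>1$, and $B_{i,j}=0$ for all $i>1$, $j\neq i$; write $b_j=B_{1,j}$ for $j\ge 2$. Let $L=L(B)\subseteq\mathbb{R}^n$ be the lattice generated by the columns of $B$ (so $\det L=N$), let $L^*$ be its dual lattice, generated by the columns of $B^{-T}$, and let $\eta_\varepsilon(L)$ be the smoothing parameter, i.e. the smallest $s>0$ with $\sum_{w\in L^*\setminus\{0\}}e^{-\pi s^2\|w\|^2}\le\varepsilon$. Identify $\mathbb{F}_N^n$ with the integer cube $\{0,\dots,N-1\}^n$ with addition modulo $N$, and for a lattice $M$ put $M_N=M\cap\mathbb{F}_N^n$. Assume that $1+\sum_{j=2}^n b_j^2\not\equiv 0\pmod N$. For $x\in\mathbb{F}_N^n$ let $\Phi_1(x)=x \bmod \mathcal{P}(B)$ be the representative of $x+L$ in the basic parallelotope $\mathcal{P}(B)=\{Bt : t\in[0,1)^n\}$. For $p$ in the image of $\Phi_1$ let $\Phi_2(p)$ be the element $y\in(NL^*)_N$ with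 $p+y\in L$, and let $\Phi_3=\Phi_2\circ\Phi_1$. Then $\Phi_3$ is well defined: for every $x\in\mathbb{F}_N^n$, $\Phi_3(x)$ is the unique $y\in(NL^*)_N$ with $x+y\in L_N$ (sum modulo $N$). Let $0<\varepsilon<1$, $s>0$ with $s\ge\eta_\varepsilon(L)$, and $c\in\mathbb{R}^n$. Let $D_{\mathbb{F}_N^n,s,c}$ be the distribution on $\mathbb{F}_N^n$ obtained by sampling $z\in\mathbb{Z}^n$ with probability proportional to $e^{-\pi\|z-c\|^2/s^2}$ and reducing its coordinates modulo $N$. If $x\sim D_{\mathbb{F}_N^n,s,c}$ and $\mathcal{D}^*$ is the distribution of $y=\Phi_3(x)$, then $$\Delta\big(\mathcal{D}^*,U[(NL^*)_N]\big)\le\varepsilon,$$ where $U[S]$ is the uniform distribution on $S$ and $\Delta(p,q)=\sum_y|p(y)-q(y)|$ (without a factor $\tfrac12$). -/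

import Mathlib

open scoped ENNReal Pointwise

noncomputable section

namespace SNF

/-- `n`-dimensional Euclidean space. -/
abbrev E (n : ℕ) : Type := EuclideanSpace ℝ (Fin n)

/-- `L(B)`: all integer combinations of the columns of `B`. -/
def latticeOf {n : ℕ} (B : Matrix (Fin n) (Fin n) ℝ) : Submodule ℤ (E n) :=
  Submodule.span ℤ (Set.range fun j : Fin n => (WithLp.toLp 2 (fun i => B i j) : E n))

/-- The dual `L(B)^*`, generated by the columns of `B⁻ᵀ`. -/
def dualLatticeOf {n : ℕ} (B : Matrix (Fin n) (Fin n) ℝ) : Submodule ℤ (E n) :=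
  latticeOf (B⁻¹).transpose

/-- An integer matrix seen as a real matrix. -/
def toReal {n : ℕ} (B : Matrix (Fin n) (Fin n) ℤ) : Matrix (Fin n) (Fin n) ℝ :=
  B.map (fun k : ℤ => (k : ℝ))

/-- Systematic normal form with respect to `N` (first row and column have index `0`):
`B 0 0 = N` is prime, the other diagonal entries are `1`, and all other entries
outside the first row vanish. -/
structure IsSNF {n : ℕ} [NeZero n] (N : ℕ) (B : Matrix (Fin n) (Fin n) ℤ) : Prop where
  prime : N.Prime
  corner : B 0 0 = (N : ℤ)
  diag : ∀ i, i ≠ 0 → B i i = 1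
  off_diag : ∀ i j, i ≠ 0 → i ≠ j → B i j = 0

/-- The Gaussian function `ρ_{s,c}(x) = exp (-π ‖x - c‖² / s²)`. -/
def rho {n : ℕ} (s : ℝ) (c x : E n) : ℝ :=
  Real.exp (-Real.pi * ‖x - c‖ ^ 2 / s ^ 2)

/-- `ρ_{s,c}(S) = ∑_{x ∈ S} ρ_{s,c}(x)`, a sum of non-negative terms in `[0, ∞]`. -/
def rhoSet {n : ℕ} (s : ℝ) (c : E n) (S : Set (E n)) : ℝ≥0∞ :=
  ∑' x : S, ENNReal.ofReal (rho s c x)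

/-- The smoothing parameter `η_ε(L(B))`: the smallest real `s > 0` with
`ρ_{1/s}(L(B)^* ∖ {0}) ≤ ε`. -/
def smoothingParameter {n : ℕ} (B : Matrix (Fin n) (Fin n) ℝ) (ε : ℝ) : ℝ :=
  sInf {s : ℝ | 0 < s ∧
    rhoSet (1 / s) 0 ((dualLatticeOf B : Set (E n)) \ {0}) ≤ ENNReal.ofReal ε}

/-- An integer vector as a point of Euclidean space. -/
def intVec {n : ℕ} (z : Fin n → ℤ) : E n := WithLp.toLp 2 (fun i => (z i : ℝ))

/-- Vectors over `ℤ/N` as points of the cube `{0, …, N-1}ⁿ`. -/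
def cubeVec {n N : ℕ} (x : Fin n → ZMod N) : E n :=
  WithLp.toLp 2 (fun i => ((x i).val : ℝ))

/-- `M_N = M ∩ F_Nⁿ`: the part of `M` in the cube `{0, …, N-1}ⁿ`, as a subset of `F_Nⁿ`. -/
def cubePart {n : ℕ} (N : ℕ) (M : Submodule ℤ (E n)) : Set (Fin n → ZMod N) :=
  {x | cubeVec x ∈ M}

/-- `L_N` for `L = L(B)`. -/
def LN {n : ℕ} (N : ℕ) (B : Matrix (Fin n) (Fin n) ℤ) : Set (Fin n → ZMod N) :=
  cubePart N (latticeOf (toReal B))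

/-- `(N L^*)_N` for `L = L(B)`. -/
def NLdualN {n : ℕ} (N : ℕ) (B : Matrix (Fin n) (Fin n) ℤ) : Set (Fin n → ZMod N) :=
  cubePart N ((N : ℝ) • dualLatticeOf (toReal B))

/-- `Φ₁`: reduction of `x ∈ F_Nⁿ` modulo the basic parallelotope
`P(B) = {∑ᵢ tᵢ bᵢ : tᵢ ∈ [0,1)}`, obtained by replacing the coordinates of `x` in the
basis `B` by their fractional parts. -/
def phi1 {n N : ℕ} (B : Matrix (Fin n) (Fin n) ℤ) (x : Fin n → ZMod N) : E n :=
  WithLp.toLp 2 ((toReal B).mulVec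
    (fun i => Int.fract (((toReal B)⁻¹).mulVec (cubeVec x).ofLp i)))

open scoped Classical in
/-- `Φ₂`: sends `p ∈ P(B)` to the element `y` of `(N L^*)_N` for which `p + y ∈ L`
(to `0` if there is none). -/
def phi2 {n : ℕ} (N : ℕ) (B : Matrix (Fin n) (Fin n) ℤ) (p : E n) : Fin n → ZMod N :=
  if h : ∃ y, y ∈ NLdualN N B ∧ p + cubeVec y ∈ latticeOf (toReal B) then h.choose else 0

/-- `Φ₃ = Φ₂ ∘ Φ₁`. -/
def phi3 {n N : ℕ} (B : Matrix (Fin n) (Fin n) ℤ) (x : Fin n → ZMod N) : Fin n → ZMod N :=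
  phi2 N B (phi1 B x)

theorem summable_prod_int {n : ℕ} (f : Fin n → ℤ → ℝ) (h0 : ∀ i k, 0 ≤ f i k)
    (hf : ∀ i, Summable (f i)) : Summable fun z : Fin n → ℤ => ∏ i, f i (z i) := by
  induction n with
  | zero => exact Summable.of_finite
  | succ m ih =>
    rw [← (Fin.consEquiv (fun _ : Fin (m + 1) => ℤ)).summable_iff]
    have h := (hf 0).mul_of_nonneg (ih (fun i => f i.succ) (fun i => h0 _) (fun i => hf _))
      (h0 0) (fun z => Finset.prod_nonneg fun i _ => h0 _ _)
    refine h.congr fun p => ?_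
    simp [Fin.prod_univ_succ, Fin.consEquiv]

theorem summable_rho {n : ℕ} {s : ℝ} (hs : 0 < s) (c : E n) :
    Summable fun z : Fin n → ℤ => rho s c (intVec z) := by
  have h1 : ∀ i : Fin n, Summable fun k : ℤ =>
      Real.exp (-Real.pi * ((k : ℝ) - c i) ^ 2 / s ^ 2) := by
    intro i
    have := HurwitzKernelBounds.summable_f_int 0 (-(c i)) (t := 1 / s ^ 2) (by positivity)
    refine this.congr fun k => ?_
    simp only [HurwitzKernelBounds.f_int, pow_zero, one_mul]
    congr 1
    ring
  refine (summable_prod_int _ (fun i k => (Real.exp_pos _).le) h1).congr fun z => ?_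
  rw [← Real.exp_sum]
  simp only [rho, intVec, EuclideanSpace.norm_sq_eq]
  congr 1
  rw [Finset.mul_sum, Finset.sum_div]
  refine Finset.sum_congr rfl fun i _ => ?_
  simp

/-- The discrete Gaussian `D_{ℤⁿ,s,c}`, with mass `ρ_{s,c}(z) / ρ_{s,c}(ℤⁿ)` at `z`. -/
def discreteGaussian {n : ℕ} (s : ℝ) (hs : 0 < s) (c : E n) : PMF (Fin n → ℤ) :=
  PMF.normalize (fun z => ENNReal.ofReal (rho s c (intVec z)))
    (fun h => by
      have h1 := ENNReal.tsum_eq_zero.1 h 0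
      rw [ENNReal.ofReal_eq_zero] at h1
      exact absurd h1 (not_le.2 (Real.exp_pos _)))
    (summable_rho hs c).tsum_ofReal_ne_top

/-- `D_{F_Nⁿ,s,c}`: the discrete Gaussian on `ℤⁿ` with each coordinate reduced modulo `N`. -/
def discreteGaussianMod {n : ℕ} (N : ℕ) (s : ℝ) (hs : 0 < s) (c : E n) :
    PMF (Fin n → ZMod N) :=
  (discreteGaussian s hs c).map (fun z i => (z i : ZMod N))

theorem zero_mem_cubePart {n : ℕ} (N : ℕ) (M : Submodule ℤ (E n)) : 0 ∈ cubePart N M := by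
  have h : cubeVec (0 : Fin n → ZMod N) = 0 := by
    ext i
    simp [cubeVec]
  simp [cubePart, h]

/-- The uniform distribution `U[(N L^*)_N]`. -/
def uniformNLdualN {n : ℕ} (N : ℕ) [NeZero N] (B : Matrix (Fin n) (Fin n) ℤ) :
    PMF (Fin n → ZMod N) :=
  PMF.uniformOfFinset (Set.toFinite (NLdualN N B)).toFinset
    ⟨0, (Set.Finite.mem_toFinset _).2 (zero_mem_cubePart N _)⟩

/-- The statistical distance `Δ(p, q) = ∑ |p(x) - q(x)|` (without a factor `1/2`). -/
def statDist {α : Type*} [Fintype α] (p q : PMF α) : ℝ :=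
  ∑ x, |(p x).toReal - (q x).toReal|

end SNF

end

/-!
Let `w = (1, -b₂, …, -bₙ)`. Both lattices are described by this one vector modulo `N`: an integer
vector `z` lies in `L` exactly when `ℓ(z) = ∑ wᵢ zᵢ` vanishes modulo `N`
(`intVec_mem_latticeOf_iff`), and `(N L^*)_N` consists of the multiples of `w` (`mem_NLdualN_iff`).
As `ℓ(w) = 1 + ∑ bⱼ²` is invertible modulo `N`, the form `ℓ` maps `(N L^*)_N` bijectively onto
`ℤ/N`, so that `Φ₃(x)` is the unique `y ∈ (N L^*)_N` with `ℓ(y) = -ℓ(x)` (`phi3_spec`,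
`eq_phi3_iff`).

It remains to show that `ℓ(z)` is nearly uniform for `z` drawn from the discrete Gaussian.
Expanding the indicator of a residue class in the characters of `ℤ/N` gives
`N ρ(ℓ(z) = -v) = ∑ᵤ χ(u v) Sᵤ` with `Sᵤ = ∑_z ρ_{s,c}(z) χ(u ℓ(z))`, and `S₀ = ρ_{s,c}(ℤⁿ)`.
Each `Sᵤ` is a Gaussian sum over `ℤⁿ` twisted by a character, and so a product of one-dimensional
sums to which the classical Poisson formula applies (`tsum_rho_mul_exp`). Hence `|Sᵤ|` is at most
`sⁿ` times the mass of `ρ_{1/s}` on the coset `ℤⁿ - (u/N) w` of `L^*`, while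
`S₀ ≥ sⁿ (1 - ρ_{1/s}(ℤⁿ ∖ {0}))`. The cosets partition `L^*`, so with
`ε₁ = ρ_{1/s}(ℤⁿ ∖ {0})` and `ε₂ = ρ_{1/s}(L^* ∖ ℤⁿ)` the smoothing condition reads
`ε₁ + ε₂ ≤ ε`, and the relative error of each class is at most
`ε₂ / (1 - ε₁) ≤ (ε - ε₁) / (1 - ε₁) ≤ ε` (`abs_tsum_rho_congruenceForm_sub_le`).

The smoothing parameter is an infimum, and its defining inequality has to be recovered for every
`s ≥ η_ε(L)`: the set of admissible widths is nonempty (`exists_rhoSet_dual_le`), and the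
infimum is attained (`rhoSet_dual_le_of_smoothingParameter_le`).
-/

open scoped ENNReal Pointwise

namespace SNF

/-! ### Poisson summation for Gaussians on the integer lattice -/

/-- A product of absolutely convergent series over `ℤ` is an absolutely convergent series
over `ℤⁿ`. -/
theorem summable_norm_and_tsum_prod_int {n : ℕ} (f : Fin n → ℤ → ℂ)
    (hf : ∀ i, Summable fun k => ‖f i k‖) :
    (Summable fun z : Fin n → ℤ => ‖∏ i, f i (z i)‖) ∧
      ∑' z : Fin n → ℤ, ∏ i, f i (z i) = ∏ i, ∑' k, f i k := by
  induction n with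
  | zero => exact ⟨Summable.of_finite, by simp⟩
  | succ m ih =>
    obtain ⟨h1, h2⟩ := ih (fun i => f i.succ) (fun i => hf _)
    constructor
    · rw [← (Fin.consEquiv (fun _ : Fin (m + 1) => ℤ)).summable_iff]
      refine ((hf 0).mul_of_nonneg h1 (fun _ => norm_nonneg _)
        (fun _ => norm_nonneg _)).congr fun p => ?_
      simp [Fin.prod_univ_succ, Fin.consEquiv]
    · rw [← (Fin.consEquiv (fun _ : Fin (m + 1) => ℤ)).tsum_eq, Fin.prod_univ_succ, ← h2,
        tsum_mul_tsum_of_summable_norm (hf 0) h1]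
      refine tsum_congr fun p => ?_
      simp [Fin.prod_univ_succ, Fin.consEquiv]

theorem summable_gaussian_int {s : ℝ} (hs : 0 < s) (c : ℝ) :
    Summable fun k : ℤ => Real.exp (-Real.pi * ((k : ℝ) - c) ^ 2 / s ^ 2) := by
  refine (HurwitzKernelBounds.summable_f_int 0 (-c) (t := 1 / s ^ 2) (by positivity)).congr
    fun k => ?_
  simp only [HurwitzKernelBounds.f_int, pow_zero, one_mul]
  congr 1
  ring

/-- One-dimensional Poisson summation, from the functional equation of the theta series with
parameters `a = s⁻²` and `b = c / s² + i θ`. -/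
theorem tsum_gaussian_mul_exp_int {s : ℝ} (hs : 0 < s) (c θ : ℝ) :
    ∑' k : ℤ, (Real.exp (-Real.pi * ((k : ℝ) - c) ^ 2 / s ^ 2) : ℂ) *
        Complex.exp (2 * Real.pi * Complex.I * (k * θ)) =
      s * ∑' m : ℤ, (Real.exp (-Real.pi * ((m : ℝ) - θ) ^ 2 / (1 / s) ^ 2) : ℂ) *
        Complex.exp (-(2 * Real.pi * Complex.I * (c * (m - θ)))) := by
  have hsC : (s : ℂ) ≠ 0 := by exact_mod_cast hs.ne'
  have ha : 0 < (((1 / s ^ 2 : ℝ)) : ℂ).re := by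
    rw [Complex.ofReal_re]; positivity
  have key := Complex.tsum_exp_neg_quadratic ha (c / s ^ 2 + Complex.I * θ)
  have hroot : 1 / (((1 / s ^ 2 : ℝ)) : ℂ) ^ (1 / 2 : ℂ) = s := by
    have h : (((1 / s ^ 2 : ℝ)) : ℂ) ^ (1 / 2 : ℂ) = ((1 / s : ℝ) : ℂ) := by
      have : ((1 / 2 : ℂ)) = ((1 / 2 : ℝ) : ℂ) := by push_cast; rfl
      rw [this, ← Complex.ofReal_cpow (by positivity), ← Real.sqrt_eq_rpow]
      congr 1
      rw [Real.sqrt_eq_iff_mul_self_eq (by positivity) (by positivity)]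
      field_simp
    rw [h]; push_cast; field_simp
  rw [hroot] at key
  calc _ = Complex.exp (-Real.pi * c ^ 2 / s ^ 2) * ∑' k : ℤ,
        Complex.exp (-Real.pi * ((1 / s ^ 2 : ℝ) : ℂ) * k ^ 2 +
          2 * Real.pi * (c / s ^ 2 + Complex.I * θ) * k) := by
        rw [← tsum_mul_left]
        refine tsum_congr fun k => ?_
        rw [Complex.ofReal_exp, ← Complex.exp_add, ← Complex.exp_add]
        congr 1
        push_cast
        field_simp
        ring
    _ = _ := by
        rw [key, mul_left_comm, ← tsum_mul_left]
        congr 1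
        refine tsum_congr fun m => ?_
        rw [Complex.ofReal_exp, ← Complex.exp_add, ← Complex.exp_add]
        congr 1
        push_cast
        field_simp
        ring_nf
        simp only [Complex.I_sq, show Complex.I ^ 3 = -Complex.I from Complex.I_pow_three,
          Complex.I_pow_four]
        ring

theorem intVec_zero {n : ℕ} : intVec (0 : Fin n → ℤ) = 0 := by
  ext i
  simp [intVec]

theorem rho_pos {n : ℕ} (s : ℝ) (c x : E n) : 0 < rho s c x := Real.exp_pos _

theorem rho_intVec_eq_prod {n : ℕ} (s : ℝ) (c : E n) (z : Fin n → ℤ) :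
    rho s c (intVec z) = ∏ i, Real.exp (-Real.pi * ((z i : ℝ) - c i) ^ 2 / s ^ 2) := by
  rw [← Real.exp_sum]
  simp only [rho, intVec, EuclideanSpace.norm_sq_eq]
  congr 1
  rw [Finset.mul_sum, Finset.sum_div]
  refine Finset.sum_congr rfl fun i _ => ?_
  simp

/-- Poisson summation for a Gaussian on `ℤⁿ` twisted by the character with frequency `θ`. -/
theorem tsum_rho_mul_exp {n : ℕ} {s : ℝ} (hs : 0 < s) (c θ : E n) :
    ∑' z : Fin n → ℤ, (rho s c (intVec z) : ℂ) *
        Complex.exp (2 * Real.pi * Complex.I * ∑ i, (z i : ℂ) * θ i) =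
      s ^ n * ∑' m : Fin n → ℤ, (rho (1 / s) θ (intVec m) : ℂ) *
        Complex.exp (-(2 * Real.pi * Complex.I * ∑ i, (c i : ℂ) * (m i - θ i))) := by
  have hl := (summable_norm_and_tsum_prod_int (n := n) (fun i (k : ℤ) =>
    (Real.exp (-Real.pi * ((k : ℝ) - c i) ^ 2 / s ^ 2) : ℂ) *
        Complex.exp (2 * Real.pi * Complex.I * (k * θ i))) (fun i => by
    refine (summable_gaussian_int hs (c i)).congr fun k => ?_
    have : (2 * Real.pi * Complex.I * (k * θ i) : ℂ) =
      ((2 * Real.pi * (k * θ i) : ℝ) : ℂ) * Complex.I := by push_cast; ring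
    rw [norm_mul, this, Complex.norm_exp_ofReal_mul_I, mul_one, Complex.norm_real,
      Real.norm_of_nonneg (Real.exp_pos _).le])).2
  have hr := (summable_norm_and_tsum_prod_int (n := n) (fun i (m : ℤ) =>
    (Real.exp (-Real.pi * ((m : ℝ) - θ i) ^ 2 / (1 / s) ^ 2) : ℂ) *
        Complex.exp (-(2 * Real.pi * Complex.I * (c i * (m - θ i))))) (fun i => by
    refine (summable_gaussian_int (one_div_pos.2 hs) (θ i)).congr fun m => ?_
    have : (-(2 * Real.pi * Complex.I * (c i * (m - θ i))) : ℂ) =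
      ((-(2 * Real.pi * (c i * (m - θ i))) : ℝ) : ℂ) * Complex.I := by push_cast; ring
    rw [norm_mul, this, Complex.norm_exp_ofReal_mul_I, mul_one, Complex.norm_real,
      Real.norm_of_nonneg (Real.exp_pos _).le])).2
  simp only [tsum_gaussian_mul_exp_int hs] at hl
  rw [Finset.prod_mul_distrib, Finset.prod_const, Finset.card_univ, Fintype.card_fin, ← hr] at hl
  simp only [Finset.prod_mul_distrib, ← Complex.exp_sum, ← Complex.ofReal_prod,
    ← rho_intVec_eq_prod, Finset.sum_neg_distrib, ← Finset.mul_sum] at hl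
  exact hl

theorem norm_tsum_rho_mul_exp_le {n : ℕ} {s : ℝ} (hs : 0 < s) (c θ : E n) :
    ‖∑' z : Fin n → ℤ, (rho s c (intVec z) : ℂ) *
        Complex.exp (2 * Real.pi * Complex.I * ∑ i, (z i : ℂ) * θ i)‖ ≤
      s ^ n * ∑' m : Fin n → ℤ, rho (1 / s) θ (intVec m) := by
  rw [tsum_rho_mul_exp hs, norm_mul, norm_pow, Complex.norm_real, Real.norm_of_nonneg hs.le]
  refine mul_le_mul_of_nonneg_left ?_ (by positivity)
  refine tsum_of_norm_bounded (summable_rho (one_div_pos.2 hs) θ).hasSum fun m => ?_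
  have : (-(2 * Real.pi * Complex.I * ∑ i, (c i : ℂ) * (m i - θ i)) : ℂ) =
      ((-(2 * Real.pi * ∑ i, c i * (m i - θ i)) : ℝ) : ℂ) * Complex.I := by push_cast; ring
  rw [norm_mul, this, Complex.norm_exp_ofReal_mul_I, mul_one, Complex.norm_real,
      Real.norm_of_nonneg (rho_pos _ _ _).le]

/-- The dual term at `0` contributes exactly `sⁿ`; the other dual terms are bounded by
their absolute values. -/
theorem le_tsum_rho_intVec {n : ℕ} {s : ℝ} (hs : 0 < s) (c : E n) :
    s ^ n * (2 - ∑' m : Fin n → ℤ, rho (1 / s) 0 (intVec m)) ≤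
      ∑' z : Fin n → ℤ, rho s c (intVec z) := by
  have hS := summable_rho (n := n) (one_div_pos.2 hs) 0
  set f : (Fin n → ℤ) → ℂ := fun m => (rho (1 / s) 0 (intVec m) : ℂ) *
        Complex.exp (-(2 * Real.pi * Complex.I * ∑ i, (c i : ℂ) * (m i - (0 : E n) i))) with hf
  have hn : ∀ m, ‖f m‖ = rho (1 / s) 0 (intVec m) := by
    intro m
    have : (-(2 * Real.pi * Complex.I * ∑ i, (c i : ℂ) * (m i - (0 : E n) i)) : ℂ) =
      ((-(2 * Real.pi * ∑ i, c i * (m i - (0 : E n) i)) : ℝ) : ℂ) * Complex.I := by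
      push_cast; ring
    rw [hf]
    simp only
    rw [norm_mul, this, Complex.norm_exp_ofReal_mul_I, mul_one, Complex.norm_real,
      Real.norm_of_nonneg (rho_pos _ _ _).le]
  have h0 : rho (1 / s) 0 (intVec (0 : Fin n → ℤ)) = 1 := by
    simp [rho, intVec_zero]
  have hf0 : f 0 = 1 := by
    simp only [hf, h0]; simp
  have hfs : Summable f := Summable.of_norm (hS.congr fun m => (hn m).symm)
  have hP := tsum_rho_mul_exp hs c 0
  simp only [PiLp.zero_apply, Complex.ofReal_zero, mul_zero, Finset.sum_const_zero,
    Complex.exp_zero, mul_one] at hP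
  rw [← Complex.ofReal_tsum] at hP
  have hfe : (∑' m : Fin n → ℤ, (rho (1 / s) 0 (intVec m) : ℂ) *
        Complex.exp (-(2 * Real.pi * Complex.I * ∑ i, (c i : ℂ) * (m i - 0)))) = ∑' m, f m := by
    refine tsum_congr fun m => by simp [hf]
  rw [hfe] at hP
  have hb : ‖∑' m, f m - 1‖ ≤ ∑' m : Fin n → ℤ, rho (1 / s) 0 (intVec m) - 1 := by
    have e1 := hfs.tsum_eq_add_tsum_ite 0
    have e2 := hS.tsum_eq_add_tsum_ite 0
    rw [e1, hf0, add_sub_cancel_left, e2, h0, add_sub_cancel_left]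
    refine tsum_of_norm_bounded (Summable.hasSum ?_) fun m => ?_
    · refine hS.of_nonneg_of_le (fun m => ?_) (fun m => ?_)
      · split_ifs
        exacts [le_rfl, (rho_pos _ _ _).le]
      · split_ifs
        exacts [(rho_pos _ _ _).le, le_rfl]
    · split_ifs
      · simp
      · exact (hn m).le
  have hre : (∑' z : Fin n → ℤ, rho s c (intVec z)) = s ^ n * (∑' m, f m).re := by
    have := congrArg Complex.re hP
    rw [← Complex.ofReal_pow, Complex.re_ofReal_mul, Complex.ofReal_re] at this
    exact this
  rw [hre]
  refine mul_le_mul_of_nonneg_left ?_ (by positivity)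
  have := (abs_le.1 ((Complex.abs_re_le_norm _).trans hb)).1
  rw [Complex.sub_re, Complex.one_re] at this
  linarith

/-! ### Membership in the lattice and its dual -/

/-- The integer vector `(1, -b₂, …, -bₙ)`. It defines `L` as the set of integer vectors `z` with
`∑ wᵢ zᵢ ≡ 0 (mod N)`, and it spans `N L^*` modulo `N`. -/
def congruenceVec {n : ℕ} [NeZero n] (B : Matrix (Fin n) (Fin n) ℤ) (i : Fin n) : ℤ :=
  if i = 0 then 1 else -B 0 i

theorem sum_congruenceVec_mul {n : ℕ} [NeZero n] {R : Type*} [CommRing R]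
    (B : Matrix (Fin n) (Fin n) ℤ) (z : Fin n → R) :
    ∑ i, (congruenceVec B i : R) * z i =
      z 0 - ∑ j ∈ Finset.univ.erase 0, (B 0 j : R) * z j := by
  rw [← Finset.add_sum_erase _ _ (Finset.mem_univ (0 : Fin n)), sub_eq_add_neg,
    ← Finset.sum_neg_distrib]
  congr 1
  · simp [congruenceVec]
  · refine Finset.sum_congr rfl fun j hj => ?_
    simp [congruenceVec, Finset.ne_of_mem_erase hj]

theorem sum_congruenceVec_mul_self {n : ℕ} [NeZero n] (B : Matrix (Fin n) (Fin n) ℤ) :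
    ∑ i, congruenceVec B i * congruenceVec B i =
      1 + ∑ j ∈ Finset.univ.erase (0 : Fin n), B 0 j ^ 2 := by
  rw [← Finset.add_sum_erase _ _ (Finset.mem_univ (0 : Fin n))]
  refine congrArg₂ (· + ·) ?_ (Finset.sum_congr rfl fun j hj => ?_)
  · simp [congruenceVec]
  · simp [congruenceVec, Finset.ne_of_mem_erase hj, sq]

theorem mem_latticeOf_iff {n : ℕ} (M : Matrix (Fin n) (Fin n) ℝ) (v : E n) :
    v ∈ latticeOf M ↔ ∃ k : Fin n → ℤ, ∀ i, v i = ∑ j, M i j * k j := by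
  rw [latticeOf, Submodule.mem_span_range_iff_exists_fun]
  refine exists_congr fun k => ?_
  rw [PiLp.ext_iff]
  refine forall_congr' fun i => ?_
  rw [eq_comm]
  simp [mul_comm]

theorem IsSNF.sum_row_mul {n : ℕ} [NeZero n] {N : ℕ} {B : Matrix (Fin n) (Fin n) ℤ}
    (hB : IsSNF N B) {R : Type*} [CommRing R] (k : Fin n → R) {i : Fin n} (hi : i ≠ 0) :
    ∑ j, (B i j : R) * k j = k i := by
  rw [Finset.sum_eq_single i (fun j _ hj => by simp [hB.off_diag i j hi hj.symm]) (by simp),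
    hB.diag i hi]
  simp

theorem IsSNF.sum_zero_row_mul {n : ℕ} [NeZero n] {N : ℕ} {B : Matrix (Fin n) (Fin n) ℤ}
    (hB : IsSNF N B) {R : Type*} [CommRing R] (k : Fin n → R) :
    ∑ j, (B 0 j : R) * k j = N * k 0 + ∑ j ∈ Finset.univ.erase 0, (B 0 j : R) * k j := by
  rw [← Finset.add_sum_erase _ _ (Finset.mem_univ (0 : Fin n)), hB.corner]
  simp

theorem intVec_mem_latticeOf_iff {n : ℕ} [NeZero n] {N : ℕ} {B : Matrix (Fin n) (Fin n) ℤ}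
    (hB : IsSNF N B) (z : Fin n → ℤ) :
    intVec z ∈ latticeOf (toReal B) ↔ (N : ℤ) ∣ ∑ i, congruenceVec B i * z i := by
  have hsum := sum_congruenceVec_mul (R := ℤ) B z
  simp only [Int.cast_id] at hsum
  have h1 : intVec z ∈ latticeOf (toReal B) ↔ ∃ k : Fin n → ℤ, ∀ i, z i = ∑ j, B i j * k j := by
    rw [mem_latticeOf_iff]
    refine exists_congr fun k => forall_congr' fun i => ?_
    simp only [intVec, toReal, Matrix.map_apply]
    norm_cast
  rw [h1, hsum]
  constructor
  · rintro ⟨k, hk⟩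
    have h0 := hk 0
    have := hB.sum_zero_row_mul (R := ℤ) k
    simp only [Int.cast_id] at this
    rw [this] at h0
    refine ⟨k 0, ?_⟩
    rw [h0, sub_eq_iff_eq_add, add_right_inj]
    refine Finset.sum_congr rfl fun j hj => ?_
    have := hB.sum_row_mul (R := ℤ) k (Finset.ne_of_mem_erase hj)
    simp only [Int.cast_id] at this
    rw [hk j, this]
  · rintro ⟨t, ht⟩
    refine ⟨Function.update z 0 t, fun i => ?_⟩
    by_cases hi : i = 0
    · subst hi
      have := hB.sum_zero_row_mul (R := ℤ) (Function.update z 0 t)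
      simp only [Int.cast_id] at this
      rw [this, Function.update_self, ← ht, sub_add_eq_add_sub, eq_sub_iff_add_eq, add_right_inj]
      refine Finset.sum_congr rfl fun j hj => ?_
      rw [Function.update_of_ne (Finset.ne_of_mem_erase hj)]
    · have := hB.sum_row_mul (R := ℤ) (Function.update z 0 t) hi
      simp only [Int.cast_id] at this
      rw [this, Function.update_of_ne hi]

/-- The inverse of `B` has first row `w / N` and agrees with the identity below it. -/
theorem IsSNF.inv_toReal {n : ℕ} [NeZero n] {N : ℕ} [NeZero N] {B : Matrix (Fin n) (Fin n) ℤ}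
    (hB : IsSNF N B) :
    (toReal B)⁻¹ = Matrix.of fun i j =>
      if i = 0 then (congruenceVec B j : ℝ) / N else if i = j then 1 else 0 := by
  have hN : (N : ℝ) ≠ 0 := NeZero.ne _
  refine Matrix.inv_eq_right_inv ?_
  ext i j
  rw [Matrix.mul_apply]
  simp only [toReal, Matrix.map_apply]
  by_cases hi : i = 0
  · subst hi
    rw [hB.sum_zero_row_mul]
    have : ∑ k ∈ Finset.univ.erase (0 : Fin n), (B 0 k : ℝ) *
        (Matrix.of fun i j => if i = 0 then (congruenceVec B j : ℝ) / N
          else if i = j then (1 : ℝ) else 0) k j =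
        ∑ k ∈ Finset.univ.erase (0 : Fin n), if k = j then (B 0 k : ℝ) else 0 := by
      refine Finset.sum_congr rfl fun k hk => ?_
      simp [Finset.ne_of_mem_erase hk]
    rw [this, Finset.sum_ite_eq']
    by_cases hj : j = 0
    · subst hj
      simp [congruenceVec, hN]
    · simp [congruenceVec, hj, Ne.symm hj]
      field_simp
      ring
  · rw [hB.sum_row_mul _ hi]
    simp [hi, Matrix.one_apply]

theorem mem_dualLatticeOf_iff {n : ℕ} [NeZero n] {N : ℕ} [NeZero N]
    {B : Matrix (Fin n) (Fin n) ℤ} (hB : IsSNF N B) (v : E n) :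
    v ∈ dualLatticeOf (toReal B) ↔
      ∃ (a : ℤ) (m : Fin n → ℤ), ∀ i, v i = a * congruenceVec B i / N + m i := by
  have hN : (N : ℝ) ≠ 0 := NeZero.ne _
  rw [dualLatticeOf, mem_latticeOf_iff, hB.inv_toReal]
  have hk : ∀ (k : Fin n → ℤ) (i : Fin n), (∑ j, (Matrix.of fun i j =>
      if i = 0 then (congruenceVec B j : ℝ) / N else if i = j then 1 else 0).transpose i j * k j) =
      congruenceVec B i / N * k 0 + if i = 0 then 0 else (k i : ℝ) := by
    intro k i
    rw [← Finset.add_sum_erase _ _ (Finset.mem_univ (0 : Fin n))]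
    have : ∑ j ∈ Finset.univ.erase (0 : Fin n), (Matrix.of fun i j =>
        if i = 0 then (congruenceVec B j : ℝ) / N
          else if i = j then 1 else 0).transpose i j * k j =
        ∑ j ∈ Finset.univ.erase (0 : Fin n), if j = i then (k j : ℝ) else 0 := by
      refine Finset.sum_congr rfl fun j hj => ?_
      simp [Finset.ne_of_mem_erase hj]
    rw [this, Finset.sum_ite_eq']
    simp
  simp only [hk]
  constructor
  · rintro ⟨k, h⟩
    refine ⟨k 0, fun i => if i = 0 then 0 else k i, fun i => ?_⟩
    rw [h i]
    push_cast
    ring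
  · rintro ⟨a, m, h⟩
    refine ⟨fun i => if i = 0 then a + N * m 0 else m i - m 0 * congruenceVec B i, fun i => ?_⟩
    rw [h i]
    by_cases hi : i = 0
    · subst hi
      simp [congruenceVec]
      field_simp
    · simp [hi]
      field_simp
      ring

theorem cubeVec_eq_intVec {n N : ℕ} (x : Fin n → ZMod N) :
    cubeVec x = intVec fun i => ((x i).val : ℤ) := by
  ext i
  simp [cubeVec, intVec]

theorem mem_NLdualN_iff {n : ℕ} [NeZero n] {N : ℕ} [NeZero N]
    {B : Matrix (Fin n) (Fin n) ℤ} (hB : IsSNF N B) (y : Fin n → ZMod N) :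
    y ∈ NLdualN N B ↔ ∃ a : ZMod N, y = fun i => a * (congruenceVec B i : ZMod N) := by
  have hN : (N : ℝ) ≠ 0 := NeZero.ne _
  have h1 : y ∈ NLdualN N B ↔
      ∃ (a : ℤ) (m : Fin n → ℤ), ∀ i, ((y i).val : ℤ) = a * congruenceVec B i + N * m i := by
    rw [NLdualN, cubePart, Set.mem_ofPred_eq, Submodule.mem_smul_pointwise_iff_exists]
    simp only [mem_dualLatticeOf_iff hB]
    constructor
    · rintro ⟨v, ⟨a, m, h⟩, hv⟩
      refine ⟨a, m, fun i => ?_⟩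
      have := congrArg (fun u : E n => u i) hv
      simp only [PiLp.smul_apply, h i, cubeVec, smul_eq_mul] at this
      rw [mul_add, mul_div_cancel₀ _ hN] at this
      exact_mod_cast this.symm
    · rintro ⟨a, m, h⟩
      refine ⟨(N : ℝ)⁻¹ • cubeVec y, ⟨a, m, fun i => ?_⟩, smul_inv_smul₀ hN _⟩
      have : (((y i).val : ℤ) : ℝ) = a * congruenceVec B i + N * m i := by
        exact_mod_cast h i
      simp only [PiLp.smul_apply, cubeVec, smul_eq_mul]
      rw [Int.cast_natCast] at this
      rw [this]
      field_simp
  rw [h1]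
  constructor
  · rintro ⟨a, m, h⟩
    refine ⟨a, funext fun i => ?_⟩
    have := congrArg (Int.cast (R := ZMod N)) (h i)
    simpa using this
  · rintro ⟨a, rfl⟩
    have : ∀ i, ∃ t : ℤ, ((a * (congruenceVec B i : ZMod N)).val : ℤ) =
        a.val * congruenceVec B i + N * t := by
      intro i
      have h : (((a.val : ℤ) * congruenceVec B i : ℤ) : ZMod N) =
          (((a * (congruenceVec B i : ZMod N)).val : ℤ) : ZMod N) := by simp
      rw [ZMod.intCast_eq_intCast_iff_dvd_sub] at h
      obtain ⟨t, ht⟩ := h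
      exact ⟨t, by linarith⟩
    choose m hm using this
    exact ⟨a.val, m, hm⟩

/-- The linear form `x ↦ ∑ wᵢ xᵢ` on `F_Nⁿ` whose kernel is `L_N`. -/
def congruenceForm {n N : ℕ} [NeZero n] (B : Matrix (Fin n) (Fin n) ℤ) (x : Fin n → ZMod N) :
    ZMod N :=
  ∑ i, (congruenceVec B i : ZMod N) * x i

theorem congruenceForm_add {n N : ℕ} [NeZero n] (B : Matrix (Fin n) (Fin n) ℤ)
    (x y : Fin n → ZMod N) :
    congruenceForm B (x + y) = congruenceForm B x + congruenceForm B y := by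
  simp [congruenceForm, mul_add, Finset.sum_add_distrib]

theorem intVec_mem_latticeOf_iff_congruenceForm {n : ℕ} [NeZero n] {N : ℕ}
    {B : Matrix (Fin n) (Fin n) ℤ} (hB : IsSNF N B) (z : Fin n → ℤ) :
    intVec z ∈ latticeOf (toReal B) ↔ congruenceForm B (fun i => (z i : ZMod N)) = 0 := by
  rw [intVec_mem_latticeOf_iff hB, ← ZMod.intCast_zmod_eq_zero_iff_dvd]
  simp [congruenceForm]

theorem mem_LN_iff {n : ℕ} [NeZero n] {N : ℕ} [NeZero N]
    {B : Matrix (Fin n) (Fin n) ℤ} (hB : IsSNF N B) (x : Fin n → ZMod N) :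
    x ∈ LN N B ↔ congruenceForm B x = 0 := by
  rw [LN, cubePart, Set.mem_ofPred_eq, cubeVec_eq_intVec,
    intVec_mem_latticeOf_iff_congruenceForm hB]
  simp

theorem IsSNF.isUnit_det_toReal {n : ℕ} [NeZero n] {N : ℕ} [NeZero N]
    {B : Matrix (Fin n) (Fin n) ℤ} (hB : IsSNF N B) : IsUnit (toReal B).det := by
  have hN : (N : ℝ) ≠ 0 := NeZero.ne _
  have h : (toReal B).BlockTriangular id := by
    intro i j hij
    have hi : i ≠ 0 := by
      rintro rfl
      exact absurd hij (by simp)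
    simp [toReal, hB.off_diag i j hi (ne_of_gt hij)]
  rw [Matrix.det_of_isUpperTriangular h, isUnit_iff_ne_zero, Finset.prod_ne_zero_iff]
  intro i _
  by_cases hi : i = 0
  · subst hi
    simp [toReal, hB.corner, hN]
  · simp [toReal, hB.diag i hi]

theorem cubeVec_sub_phi1_mem {n : ℕ} [NeZero n] {N : ℕ} [NeZero N]
    {B : Matrix (Fin n) (Fin n) ℤ} (hB : IsSNF N B) (x : Fin n → ZMod N) :
    cubeVec x - phi1 B x ∈ latticeOf (toReal B) := by
  rw [mem_latticeOf_iff]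
  refine ⟨fun j => ⌊((toReal B)⁻¹).mulVec (cubeVec x).ofLp j⌋, fun i => ?_⟩
  have h : (toReal B).mulVec (((toReal B)⁻¹).mulVec (cubeVec x).ofLp) = (cubeVec x).ofLp := by
    rw [Matrix.mulVec_mulVec, Matrix.mul_nonsing_inv _ hB.isUnit_det_toReal, Matrix.one_mulVec]
  have hi := congrFun h i
  rw [PiLp.sub_apply, ← hi]
  simp only [phi1, Matrix.mulVec, dotProduct, ← Finset.sum_sub_distrib, ← mul_sub, Int.fract]
  simp

/-- The condition defining `Φ₂` sees only the class of `Φ₁ x` modulo `L`, that is, of `x`; and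
since `N ℤⁿ ⊆ L`, addition in `ℝⁿ` may be replaced by addition modulo `N`. -/
theorem phi1_add_cubeVec_mem_iff {n : ℕ} [NeZero n] {N : ℕ} [NeZero N]
    {B : Matrix (Fin n) (Fin n) ℤ} (hB : IsSNF N B) (x y : Fin n → ZMod N) :
    phi1 B x + cubeVec y ∈ latticeOf (toReal B) ↔ x + y ∈ LN N B := by
  have h : phi1 B x + cubeVec y = (cubeVec x + cubeVec y) - (cubeVec x - phi1 B x) := by abel
  rw [h, Submodule.sub_mem_iff_left _ (cubeVec_sub_phi1_mem hB x), mem_LN_iff hB]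
  have h2 : (cubeVec x + cubeVec y : E n) = intVec fun i => ((x i).val : ℤ) + ((y i).val : ℤ) := by
    ext i
    simp [cubeVec, intVec]
  rw [h2, intVec_mem_latticeOf_iff_congruenceForm hB]
  have : (fun i => ((((x i).val : ℤ) + ((y i).val : ℤ) : ℤ) : ZMod N)) = x + y := by
    ext i
    simp
  rw [this]

/-! ### The map `Φ₃` -/

theorem congruenceForm_smul_congruenceVec {n N : ℕ} [NeZero n] (B : Matrix (Fin n) (Fin n) ℤ)
    (a : ZMod N) :
    congruenceForm B (fun i => a * (congruenceVec B i : ZMod N)) =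
      a * ((1 + ∑ j ∈ Finset.univ.erase (0 : Fin n), B 0 j ^ 2 : ℤ) : ZMod N) := by
  rw [← sum_congruenceVec_mul_self, congruenceForm, Int.cast_sum, Finset.mul_sum]
  refine Finset.sum_congr rfl fun i _ => ?_
  push_cast
  ring

/-- The linear form restricts to a bijection from `(N L^*)_N` onto `ℤ/N`: on the multiple
`a w` it takes the value `a (1 + ∑ bⱼ²)`, and `1 + ∑ bⱼ²` is invertible. -/
theorem existsUnique_mem_NLdualN {n : ℕ} [NeZero n] {N : ℕ} [NeZero N]
    {B : Matrix (Fin n) (Fin n) ℤ} (hB : IsSNF N B)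
    (hinv : ¬ (N : ℤ) ∣ 1 + ∑ j ∈ Finset.univ.erase (0 : Fin n), B 0 j ^ 2) (v : ZMod N) :
    ∃! y, y ∈ NLdualN N B ∧ congruenceForm B y = v := by
  have : Fact N.Prime := ⟨hB.prime⟩
  rw [← ZMod.intCast_zmod_eq_zero_iff_dvd] at hinv
  set q : ZMod N := ((1 + ∑ j ∈ Finset.univ.erase (0 : Fin n), B 0 j ^ 2 : ℤ) : ZMod N) with hq
  refine ⟨fun i => v / q * (congruenceVec B i : ZMod N),
    ⟨(mem_NLdualN_iff hB _).2 ⟨_, rfl⟩, ?_⟩, ?_⟩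
  · rw [congruenceForm_smul_congruenceVec, ← hq, div_mul_cancel₀ _ hinv]
  · rintro y ⟨hy, hv⟩
    obtain ⟨a, rfl⟩ := (mem_NLdualN_iff hB _).1 hy
    rw [congruenceForm_smul_congruenceVec, ← hq] at hv
    rw [← hv, mul_div_cancel_right₀ _ hinv]

theorem phi3_spec {n : ℕ} [NeZero n] {N : ℕ} [NeZero N]
    {B : Matrix (Fin n) (Fin n) ℤ} (hB : IsSNF N B)
    (hinv : ¬ (N : ℤ) ∣ 1 + ∑ j ∈ Finset.univ.erase (0 : Fin n), B 0 j ^ 2)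
    (x : Fin n → ZMod N) :
    phi3 B x ∈ NLdualN N B ∧ x + phi3 B x ∈ LN N B := by
  have h : ∃ y, y ∈ NLdualN N B ∧ phi1 B x + cubeVec y ∈ latticeOf (toReal B) := by
    obtain ⟨y, ⟨hy, hv⟩, -⟩ := existsUnique_mem_NLdualN hB hinv (-congruenceForm B x)
    refine ⟨y, hy, ?_⟩
    rw [phi1_add_cubeVec_mem_iff hB, mem_LN_iff hB, congruenceForm_add, hv, add_neg_cancel]
  have := h.choose_spec
  rw [phi1_add_cubeVec_mem_iff hB] at this
  rw [phi3, phi2, dif_pos h]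
  exact this

theorem eq_phi3_iff {n : ℕ} [NeZero n] {N : ℕ} [NeZero N]
    {B : Matrix (Fin n) (Fin n) ℤ} (hB : IsSNF N B)
    (hinv : ¬ (N : ℤ) ∣ 1 + ∑ j ∈ Finset.univ.erase (0 : Fin n), B 0 j ^ 2)
    {x y : Fin n → ZMod N} (hy : y ∈ NLdualN N B) :
    y = phi3 B x ↔ congruenceForm B x + congruenceForm B y = 0 := by
  obtain ⟨h1, h2⟩ := phi3_spec hB hinv x
  rw [mem_LN_iff hB, congruenceForm_add] at h2
  constructor
  · rintro rfl
    exact h2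
  · intro h
    refine (existsUnique_mem_NLdualN hB hinv (-congruenceForm B x)).unique
      ⟨hy, ?_⟩ ⟨h1, ?_⟩ <;> rw [eq_neg_iff_add_eq_zero, add_comm]
    exacts [h, h2]

theorem card_NLdualN {n : ℕ} [NeZero n] {N : ℕ} [NeZero N]
    {B : Matrix (Fin n) (Fin n) ℤ} (hB : IsSNF N B)
    (hinv : ¬ (N : ℤ) ∣ 1 + ∑ j ∈ Finset.univ.erase (0 : Fin n), B 0 j ^ 2) :
    (Set.toFinite (NLdualN N B)).toFinset.card = N := by
  have h : Function.Bijective fun y : NLdualN N B => (congruenceForm B y.1 : ZMod N) := by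
    rw [Function.bijective_iff_existsUnique]
    intro v
    obtain ⟨y, ⟨hy, hv⟩, hu⟩ := existsUnique_mem_NLdualN hB hinv v
    exact ⟨⟨y, hy⟩, hv, fun y' h' => Subtype.ext (hu y'.1 ⟨y'.2, h'⟩)⟩
  rw [← Set.ncard_eq_toFinset_card, ← Nat.card_coe_set_eq, Nat.card_eq_of_bijective _ h,
    Nat.card_zmod]

/-! ### The smoothing parameter -/

theorem rho_one_div_zero {n : ℕ} {s : ℝ} (x : E n) :
    rho (1 / s) 0 x = Real.exp (-Real.pi * ‖x‖ ^ 2 * s ^ 2) := by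
  rw [rho, sub_zero, one_div, inv_pow, div_inv_eq_mul]

theorem rho_one_div_antitone {n : ℕ} {s t : ℝ} (hs : 0 < s) (hst : s ≤ t) (x : E n) :
    rho (1 / t) 0 x ≤ rho (1 / s) 0 x := by
  rw [rho_one_div_zero, rho_one_div_zero, Real.exp_le_exp, neg_mul, neg_mul, neg_mul, neg_le_neg_iff]
  gcongr

theorem norm_sq_intVec_ge_one {n : ℕ} {z : Fin n → ℤ} (hz : z ≠ 0) : 1 ≤ ‖(intVec z : E n)‖ ^ 2 := by
  obtain ⟨i, hi⟩ := Function.ne_iff.1 hz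
  rw [EuclideanSpace.norm_sq_eq]
  refine le_trans ?_ (Finset.single_le_sum (f := fun i => ‖(intVec z : E n) i‖ ^ 2)
    (fun i _ => by positivity) (Finset.mem_univ i))
  have h : (1 : ℤ) ≤ z i ^ 2 := Int.add_one_le_iff.2 (sq_pos_of_ne_zero hi)
  simp only [intVec, Real.norm_eq_abs, sq_abs]
  exact_mod_cast h

/-- Since `L^* ⊆ N⁻¹ ℤⁿ`, the Gaussian mass of `L^* ∖ {0}` is finite and decays exponentially
in the width, so that the infimum defining the smoothing parameter is over a nonempty set. -/
theorem exists_rhoSet_dual_le {n : ℕ} [NeZero n] {N : ℕ} [NeZero N]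
    {B : Matrix (Fin n) (Fin n) ℤ} (hB : IsSNF N B) {ε : ℝ} (hε : 0 < ε) :
    ∃ s : ℝ, 0 < s ∧
      rhoSet (1 / s) 0 ((dualLatticeOf (toReal B) : Set (E n)) \ {0}) ≤ ENNReal.ofReal ε := by
  have hN : (0 : ℝ) < N := Nat.cast_pos.2 (NeZero.pos N)
  have hv : ∀ v : ((dualLatticeOf (toReal B) : Set (E n)) \ {0} : Set (E n)),
      ∃ z : Fin n → ℤ, (N : ℝ) • v.1 = intVec z := by
    rintro ⟨v, hv, -⟩
    obtain ⟨a, m, h⟩ := (mem_dualLatticeOf_iff hB v).1 hv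
    refine ⟨fun i => a * congruenceVec B i + N * m i, ?_⟩
    ext i
    simp only [PiLp.smul_apply, h i, intVec, smul_eq_mul]
    push_cast
    field_simp
  choose f hf using hv
  have hfinj : Function.Injective f := by
    intro v v' h
    have h1 := hf v
    rw [h, ← hf v'] at h1
    exact Subtype.ext (smul_right_injective _ hN.ne' h1)
  have hf0 : ∀ v, f v ≠ 0 := by
    intro v h
    have h1 := hf v
    rw [h] at h1
    rw [intVec_zero, smul_eq_zero] at h1
    exact v.2.2 (h1.resolve_left hN.ne')
  have hS := summable_rho (n := n) one_pos 0
  set C : ℝ := ∑' z : Fin n → ℤ, rho 1 0 (intVec z) with hC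
  have hCpos : 0 < C := hS.tsum_pos (fun _ => (rho_pos _ _ _).le) 0 (rho_pos _ _ _)
  -- With `s = N r` and `r ^ 2 = 1 + t`, the mass is at most `exp (-π t) * C ≤ ε`.
  set t : ℝ := max 0 (Real.log (C / ε)) with ht
  have ht0 : 0 ≤ t := le_max_left _ _
  set r : ℝ := Real.sqrt (1 + t) with hr
  have hr2 : r ^ 2 = 1 + t := Real.sq_sqrt (by linarith)
  have hrpos : 0 < r := Real.sqrt_pos.2 (by linarith)
  have hexp : Real.exp (-Real.pi * t) * C ≤ ε := by
    have h1 : Real.exp (-Real.pi * t) ≤ Real.exp (-Real.log (C / ε)) := by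
      rw [Real.exp_le_exp]
      have := le_max_right 0 (Real.log (C / ε))
      have := Real.pi_gt_three
      nlinarith
    rw [Real.exp_neg, Real.exp_log (by positivity), inv_div] at h1
    calc _ ≤ ε / C * C := by gcongr
      _ = ε := by field_simp
  refine ⟨N * r, by positivity, ?_⟩
  calc rhoSet (1 / (N * r)) 0 ((dualLatticeOf (toReal B) : Set (E n)) \ {0})
      ≤ ∑' v, ENNReal.ofReal (Real.exp (-Real.pi * t) * rho 1 0 (intVec (f v))) := by
        refine ENNReal.tsum_le_tsum fun v => ENNReal.ofReal_le_ofReal ?_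
        have h1 : ‖v.1‖ ^ 2 * (N * r) ^ 2 = ‖(intVec (f v) : E n)‖ ^ 2 * r ^ 2 := by
          rw [← hf v, norm_smul, Real.norm_of_nonneg hN.le]
          ring
        rw [rho_one_div_zero, rho, ← Real.exp_add, Real.exp_le_exp, mul_assoc, h1, hr2, sub_zero]
        have h2 := norm_sq_intVec_ge_one (hf0 v)
        have := mul_le_mul_of_nonneg_left h2 (mul_nonneg Real.pi_pos.le ht0)
        linarith
    _ ≤ ∑' z : Fin n → ℤ, ENNReal.ofReal (Real.exp (-Real.pi * t) * rho 1 0 (intVec z)) :=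
        ENNReal.tsum_comp_le_tsum_of_injective hfinj
          fun z => ENNReal.ofReal (Real.exp (-Real.pi * t) * rho 1 0 (intVec z))
    _ = ENNReal.ofReal (Real.exp (-Real.pi * t) * C) := by
        rw [hC, ← tsum_mul_left, ENNReal.ofReal_tsum_of_nonneg
          (fun z => mul_nonneg (Real.exp_pos _).le (rho_pos _ _ _).le) (hS.mul_left _)]
    _ ≤ ENNReal.ofReal ε := ENNReal.ofReal_le_ofReal hexp

/-- The infimum defining the smoothing parameter is attained: the bound holds for all larger
widths by monotonicity, and passes to the limit by testing it on finite subsets of `L^*`. -/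
theorem rhoSet_dual_le_of_smoothingParameter_le {n : ℕ} [NeZero n] {N : ℕ} [NeZero N]
    {B : Matrix (Fin n) (Fin n) ℤ} (hB : IsSNF N B) {ε : ℝ} (hε : 0 < ε) {s : ℝ}
    (hsη : smoothingParameter (toReal B) ε ≤ s) :
    rhoSet (1 / s) 0 ((dualLatticeOf (toReal B) : Set (E n)) \ {0}) ≤ ENNReal.ofReal ε := by
  rw [rhoSet, ENNReal.tsum_eq_iSup_sum]
  refine iSup_le fun F => ?_
  have hcont : Filter.Tendsto (fun r : ℝ => ∑ x ∈ F, ENNReal.ofReal (rho (1 / r) 0 x.1))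
      (nhdsWithin s (Set.Ioi s)) (nhds (∑ x ∈ F, ENNReal.ofReal (rho (1 / s) 0 x.1))) := by
    refine Filter.Tendsto.mono_left (Continuous.tendsto ?_ s) nhdsWithin_le_nhds
    refine continuous_finsetSum _ fun x _ => ENNReal.continuous_ofReal.comp ?_
    simp only [rho_one_div_zero]
    fun_prop
  refine le_of_tendsto hcont ?_
  filter_upwards [self_mem_nhdsWithin] with r hr
  obtain ⟨q, ⟨hq0, hq⟩, hqr⟩ := exists_lt_of_csInf_lt (exists_rhoSet_dual_le hB hε)
    (lt_of_le_of_lt hsη hr)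
  refine le_trans (ENNReal.sum_le_tsum F) (le_trans (ENNReal.tsum_le_tsum fun x => ?_) hq)
  exact ENNReal.ofReal_le_ofReal (rho_one_div_antitone hq0 hqr.le _)

/-- The representative `(u / N) w` of the class of `L^*` modulo `ℤⁿ` with index `u`. -/
noncomputable def dualShift {n N : ℕ} [NeZero n] (B : Matrix (Fin n) (Fin n) ℤ) (u : ZMod N) : E n :=
  WithLp.toLp 2 fun i => (u.val : ℝ) * congruenceVec B i / N

/-- The cosets `ℤⁿ - (u / N) w` partition `L^*`; the coset `u = 0` contains the origin, whose
mass is `1`. -/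
theorem sum_tsum_rho_dualShift_le {n : ℕ} [NeZero n] {N : ℕ} [NeZero N]
    {B : Matrix (Fin n) (Fin n) ℤ} (hB : IsSNF N B) {ε : ℝ} (hε : 0 < ε) {s : ℝ} (hs : 0 < s)
    (h : rhoSet (1 / s) 0 ((dualLatticeOf (toReal B) : Set (E n)) \ {0}) ≤ ENNReal.ofReal ε) :
    ∑ u : ZMod N, ∑' m : Fin n → ℤ, rho (1 / s) (dualShift B u) (intVec m) ≤ 1 + ε := by
  have hN : (N : ℝ) ≠ 0 := NeZero.ne _
  set g : ZMod N × (Fin n → ℤ) → E n := fun p => intVec p.2 - dualShift B p.1 with hg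
  have hg0 : g 0 = 0 := by
    ext i
    simp [hg, intVec, dualShift]
  have hginj : Function.Injective g := by
    rintro ⟨u, m⟩ ⟨u', m'⟩ h
    have h0 := congrArg (fun x : E n => x 0) h
    simp only [hg, intVec, dualShift, PiLp.sub_apply, congruenceVec, if_true, Int.cast_one,
      mul_one] at h0
    field_simp at h0
    have h1 : m 0 * (N : ℤ) - u.val = N * m' 0 - u'.val := by exact_mod_cast h0
    have hu : u = u' := by
      have := congrArg (Int.cast (R := ZMod N)) h1
      simpa using this
    subst hu
    have hm : (intVec m : E n) = intVec m' := sub_left_injective h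
    have : m = m' := by
      funext i
      have := congrArg (fun x : E n => x i) hm
      simpa [intVec] using this
    rw [this]
  have hgmem : ∀ p, g p ∈ dualLatticeOf (toReal B) := by
    rintro ⟨u, m⟩
    rw [mem_dualLatticeOf_iff hB]
    refine ⟨-u.val, m, fun i => ?_⟩
    simp [hg, intVec, dualShift]
    ring
  have hgrho : ∀ u m, rho (1 / s) (dualShift B u) (intVec m) = rho (1 / s) 0 (g (u, m)) := by
    intro u m
    simp [rho, hg]
  have hsum : ∀ u : ZMod N, Summable fun m : Fin n → ℤ =>
      rho (1 / s) (dualShift B u) (intVec m) := fun u => summable_rho (one_div_pos.2 hs) _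
  rw [← ENNReal.ofReal_le_ofReal_iff (by linarith), ENNReal.ofReal_add zero_le_one hε.le,
    ENNReal.ofReal_sum_of_nonneg (fun u _ => tsum_nonneg fun m => (rho_pos _ _ _).le)]
  calc ∑ u : ZMod N, ENNReal.ofReal (∑' m : Fin n → ℤ, rho (1 / s) (dualShift B u) (intVec m))
      = ∑' p, ENNReal.ofReal (rho (1 / s) 0 (g p)) := by
        rw [ENNReal.tsum_prod', tsum_fintype]
        refine Finset.sum_congr rfl fun u _ => ?_
        rw [ENNReal.ofReal_tsum_of_nonneg (fun m => (rho_pos _ _ _).le) (hsum u)]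
        simp only [hgrho]
    _ = ENNReal.ofReal 1 + ∑' p : ({0}ᶜ : Set (ZMod N × (Fin n → ℤ))),
          ENNReal.ofReal (rho (1 / s) 0 (g p.1)) := by
        rw [← Summable.tsum_add_tsum_compl (s := {(0 : ZMod N × (Fin n → ℤ))}) ENNReal.summable
          ENNReal.summable, tsum_singleton 0 fun p => ENNReal.ofReal (rho (1 / s) 0 (g p)), hg0]
        simp [rho]
    _ ≤ _ := by
        refine add_le_add le_rfl (le_trans ?_ h)
        have hmem : ∀ p : ({0}ᶜ : Set (ZMod N × (Fin n → ℤ))),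
            g p.1 ∈ ((dualLatticeOf (toReal B) : Set (E n)) \ {0} : Set (E n)) := fun p =>
          ⟨hgmem _, fun h0 => p.2 (hginj (by rw [hg0]; exact h0))⟩
        exact ENNReal.tsum_comp_le_tsum_of_injective
          (f := fun p => (⟨g p.1, hmem p⟩ :
            ((dualLatticeOf (toReal B) : Set (E n)) \ {0} : Set (E n))))
          (fun p q hpq => Subtype.ext (hginj (congrArg Subtype.val hpq)))
          (fun x => ENNReal.ofReal (rho (1 / s) 0 x.1))

/-! ### The distribution of `Φ₃` -/

theorem discreteGaussian_toReal {n : ℕ} {s : ℝ} (hs : 0 < s) (c : E n) (z : Fin n → ℤ) :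
    (discreteGaussian s hs c z).toReal =
      rho s c (intVec z) / ∑' z : Fin n → ℤ, rho s c (intVec z) := by
  rw [discreteGaussian, PMF.normalize_apply, ← ENNReal.ofReal_tsum_of_nonneg
    (fun z => (rho_pos _ _ _).le) (summable_rho hs c), ENNReal.toReal_mul, ENNReal.toReal_inv,
    ENNReal.toReal_ofReal (rho_pos _ _ _).le,
    ENNReal.toReal_ofReal (tsum_nonneg fun z => (rho_pos _ _ _).le), div_eq_mul_inv]

theorem stdAddChar_mul_congruenceForm {n : ℕ} [NeZero n] {N : ℕ} [NeZero N]
    (B : Matrix (Fin n) (Fin n) ℤ) (u : ZMod N) (z : Fin n → ℤ) :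
    ZMod.stdAddChar (u * congruenceForm B fun i => (z i : ZMod N)) =
      Complex.exp (2 * Real.pi * Complex.I * ∑ i, (z i : ℂ) * dualShift B u i) := by
  have h : u * congruenceForm B (fun i => (z i : ZMod N)) =
      ((u.val * ∑ i, congruenceVec B i * z i : ℤ) : ZMod N) := by
    simp [congruenceForm]
  rw [h, ZMod.stdAddChar_coe]
  congr 1
  simp only [dualShift]
  push_cast
  rw [mul_div_assoc, Finset.mul_sum, Finset.sum_div]
  congr 1
  refine Finset.sum_congr rfl fun i _ => ?_
  ring

/-- Expanding the indicator of a residue class of the linear form in the characters of `ℤ/N`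
expresses its Gaussian mass through the twisted Gaussian sums. -/
theorem natCast_mul_tsum_rho_congruenceForm {n : ℕ} [NeZero n] {N : ℕ} [NeZero N]
    (B : Matrix (Fin n) (Fin n) ℤ) {s : ℝ} (hs : 0 < s) (c : E n) (v : ZMod N) :
    (N : ℂ) * ((∑' z : Fin n → ℤ, if congruenceForm B (fun i => (z i : ZMod N)) + v = 0
        then rho s c (intVec z) else 0 : ℝ) : ℂ) =
      ∑ u : ZMod N, ZMod.stdAddChar (u * v) *
        ∑' z : Fin n → ℤ, (rho s c (intVec z) : ℂ) *
          Complex.exp (2 * Real.pi * Complex.I * ∑ i, (z i : ℂ) * dualShift B u i) := by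
  have hsum : ∀ u : ZMod N, Summable fun z : Fin n → ℤ => ZMod.stdAddChar (u * v) *
      ((rho s c (intVec z) : ℂ) *
        Complex.exp (2 * Real.pi * Complex.I * ∑ i, (z i : ℂ) * dualShift B u i)) := by
    intro u
    refine Summable.mul_left _ (Summable.of_norm ((summable_rho hs c).congr fun z => ?_))
    rw [← stdAddChar_mul_congruenceForm, norm_mul, AddChar.norm_apply, mul_one, Complex.norm_real,
      Real.norm_of_nonneg (rho_pos _ _ _).le]
  simp only [← tsum_mul_left]
  rw [← Summable.tsum_finsetSum fun u _ => hsum u, Complex.ofReal_tsum, ← tsum_mul_left]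
  refine tsum_congr fun z => ?_
  have h := AddChar.sum_mulShift (congruenceForm B (fun i => (z i : ZMod N)) + v)
    (ZMod.isPrimitive_stdAddChar N)
  rw [ZMod.card] at h
  calc _ = (rho s c (intVec z) : ℂ) * ∑ u : ZMod N, ZMod.stdAddChar
        (u * (congruenceForm B (fun i => (z i : ZMod N)) + v)) := by
        rw [h]
        split_ifs <;> simp [mul_comm]
    _ = _ := by
        rw [Finset.mul_sum]
        refine Finset.sum_congr rfl fun u _ => ?_
        rw [mul_add, AddChar.map_add_eq_mul, stdAddChar_mul_congruenceForm]
        ring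

/-- Every residue class of the linear form has Gaussian mass within a relative error `ε` of
`1 / N` of the total. The total mass enters the estimate through the `u = 0` term only, which is
why no factor `2 / (1 - ε)` is lost: with `ε₁ = ρ(ℤⁿ ∖ {0})` and `ε₂ = ρ(L^* ∖ ℤⁿ)` at width `1/s`,
the relative error is at most `ε₂ / (1 - ε₁) ≤ (ε - ε₁) / (1 - ε₁) ≤ ε`. -/
theorem abs_tsum_rho_congruenceForm_sub_le {n : ℕ} [NeZero n] {N : ℕ} [NeZero N]
    (B : Matrix (Fin n) (Fin n) ℤ) {ε : ℝ} (hε1 : ε < 1) {s : ℝ} (hs : 0 < s)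
    (h : ∑ u : ZMod N, ∑' m : Fin n → ℤ, rho (1 / s) (dualShift B u) (intVec m) ≤ 1 + ε)
    (c : E n) (v : ZMod N) :
    |N * (∑' z : Fin n → ℤ, if congruenceForm B (fun i => (z i : ZMod N)) + v = 0
        then rho s c (intVec z) else 0) - ∑' z : Fin n → ℤ, rho s c (intVec z)| ≤
      ε * ∑' z : Fin n → ℤ, rho s c (intVec z) := by
  have h0 : dualShift B (0 : ZMod N) = 0 := by
    ext i
    simp [dualShift]
  have key := natCast_mul_tsum_rho_congruenceForm B hs c v
  rw [← Finset.add_sum_erase _ _ (Finset.mem_univ (0 : ZMod N)), h0] at key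
  simp only [zero_mul, AddChar.map_zero_eq_one, one_mul, PiLp.zero_apply, Complex.ofReal_zero,
    mul_zero, Finset.sum_const_zero, Complex.exp_zero, mul_one] at key
  rw [← Complex.ofReal_tsum, ← sub_eq_iff_eq_add'] at key
  rw [← Finset.add_sum_erase _ _ (Finset.mem_univ (0 : ZMod N)), h0] at h
  have hA := le_tsum_rho_intVec hs c
  set G0 : ℝ := ∑' m : Fin n → ℤ, rho (1 / s) 0 (intVec m) with hG0
  set A : ℝ := ∑' z : Fin n → ℤ, rho s c (intVec z)
  set G1 : ℝ := ∑ u ∈ Finset.univ.erase (0 : ZMod N),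
    ∑' m : Fin n → ℤ, rho (1 / s) (dualShift B u) (intVec m) with hG1
  have hG0' : 1 ≤ G0 := by
    have h1 : rho (1 / s) 0 (intVec (0 : Fin n → ℤ)) = 1 := by
      simp [rho, intVec_zero]
    rw [← h1]
    exact (summable_rho (one_div_pos.2 hs) 0).le_tsum 0 fun _ _ => (rho_pos _ _ _).le
  have hG1' : 0 ≤ G1 := Finset.sum_nonneg fun u _ => tsum_nonneg fun m => (rho_pos _ _ _).le
  have hε : 0 ≤ ε := by linarith
  have hsn : 0 < s ^ n := by positivity
  calc _ ≤ s ^ n * G1 := by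
        rw [← Real.norm_eq_abs, ← Complex.norm_real]
        rw [Complex.ofReal_sub, Complex.ofReal_mul, Complex.ofReal_natCast, key, hG1, Finset.mul_sum]
        refine norm_sum_le_of_le _ fun u _ => ?_
        rw [norm_mul, AddChar.norm_apply, one_mul]
        exact norm_tsum_rho_mul_exp_le hs c _
    _ ≤ s ^ n * (ε * (2 - G0)) := by
        refine mul_le_mul_of_nonneg_left ?_ hsn.le
        nlinarith
    _ = ε * (s ^ n * (2 - G0)) := by ring
    _ ≤ ε * A := mul_le_mul_of_nonneg_left hA hε

theorem map_phi3_eq_zero {n : ℕ} [NeZero n] {N : ℕ} [NeZero N]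
    {B : Matrix (Fin n) (Fin n) ℤ} (hB : IsSNF N B)
    (hinv : ¬ (N : ℤ) ∣ 1 + ∑ j ∈ Finset.univ.erase (0 : Fin n), B 0 j ^ 2)
    (p : PMF (Fin n → ZMod N)) {y : Fin n → ZMod N} (hy : y ∉ NLdualN N B) :
    p.map (phi3 B) y = 0 := by
  rw [PMF.map_apply, ENNReal.tsum_eq_zero]
  intro x
  rw [if_neg]
  rintro rfl
  exact hy (phi3_spec hB hinv x).1

theorem map_phi3_toReal {n : ℕ} [NeZero n] {N : ℕ} [NeZero N]
    {B : Matrix (Fin n) (Fin n) ℤ} (hB : IsSNF N B)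
    (hinv : ¬ (N : ℤ) ∣ 1 + ∑ j ∈ Finset.univ.erase (0 : Fin n), B 0 j ^ 2)
    {s : ℝ} (hs : 0 < s) (c : E n) {y : Fin n → ZMod N} (hy : y ∈ NLdualN N B) :
    ((discreteGaussianMod N s hs c).map (phi3 B) y).toReal =
      (∑' z : Fin n → ℤ, if congruenceForm B (fun i => (z i : ZMod N)) + congruenceForm B y = 0
        then rho s c (intVec z) else 0) / ∑' z : Fin n → ℤ, rho s c (intVec z) := by
  rw [discreteGaussianMod, PMF.map_comp, PMF.map_apply, ENNReal.tsum_toReal_eq, ← tsum_div_const]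
  · refine tsum_congr fun z => ?_
    have h := eq_phi3_iff hB hinv (x := fun i => (z i : ZMod N)) hy
    simp only [Function.comp_apply, h]
    split_ifs
    · exact discreteGaussian_toReal hs c z
    · simp
  · intro z
    split_ifs
    exacts [PMF.apply_ne_top _ _, ENNReal.zero_ne_top]

theorem statDist_map_phi3_le {n : ℕ} [NeZero n] {N : ℕ} [NeZero N]
    {B : Matrix (Fin n) (Fin n) ℤ} (hB : IsSNF N B)
    (hinv : ¬ (N : ℤ) ∣ 1 + ∑ j ∈ Finset.univ.erase (0 : Fin n), B 0 j ^ 2)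
    {ε : ℝ} (hε0 : 0 < ε) (hε1 : ε < 1)
    {s : ℝ} (hs : 0 < s) (hsη : smoothingParameter (toReal B) ε ≤ s) (c : E n) :
    statDist ((discreteGaussianMod N s hs c).map (phi3 B)) (uniformNLdualN N B) ≤ ε := by
  have hN : (0 : ℝ) < N := Nat.cast_pos.2 (NeZero.pos N)
  have hA : 0 < ∑' z : Fin n → ℤ, rho s c (intVec z) :=
    (summable_rho hs c).tsum_pos (fun _ => (rho_pos _ _ _).le) 0 (rho_pos _ _ _)
  have hG := sum_tsum_rho_dualShift_le hB hε0 hs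
    (rhoSet_dual_le_of_smoothingParameter_le hB hε0 hsη)
  set S := (Set.toFinite (NLdualN N B)).toFinset
  have hcard : S.card = N := card_NLdualN hB hinv
  have hmem : ∀ y, y ∈ S ↔ y ∈ NLdualN N B := fun y => Set.Finite.mem_toFinset _
  have hU : ∀ y, (uniformNLdualN N B y).toReal = if y ∈ S then (N : ℝ)⁻¹ else 0 := by
    intro y
    split_ifs with hy
    · have h : uniformNLdualN N B y = (S.card : ℝ≥0∞)⁻¹ := PMF.uniformOfFinset_apply_of_mem _ hy
      simp [h, hcard]
    · have h : uniformNLdualN N B y = 0 := PMF.uniformOfFinset_apply_of_notMem _ hy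
      simp [h]
  rw [statDist, ← Finset.sum_subset (Finset.subset_univ S)]
  · calc _ ≤ ∑ y ∈ S, ε / N := by
          refine Finset.sum_le_sum fun y hy => ?_
          have hb := abs_tsum_rho_congruenceForm_sub_le B hε1 hs hG c (congruenceForm B y)
          rw [hU, if_pos hy, map_phi3_toReal hB hinv hs c ((hmem y).1 hy)]
          set T := ∑' z : Fin n → ℤ,
            if congruenceForm B (fun i => (z i : ZMod N)) + congruenceForm B y = 0
            then rho s c (intVec z) else 0
          set A := ∑' z : Fin n → ℤ, rho s c (intVec z)
          have he : T / A - (N : ℝ)⁻¹ = (N * T - A) / (N * A) := by field_simp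
          rw [he, abs_div, abs_of_pos (mul_pos hN hA), div_le_div_iff₀ (mul_pos hN hA) hN]
          calc _ ≤ ε * A * N := by gcongr
            _ = ε * (N * A) := by ring
      _ = ε := by
          rw [Finset.sum_const, hcard, nsmul_eq_mul]
          field_simp
  · intro y _ hy
    rw [hU, if_neg hy, map_phi3_eq_zero hB hinv _ (mt (hmem y).2 hy)]
    simp

end SNF

theorem mainTheorem7 {n : ℕ} [NeZero n] {N : ℕ} [NeZero N]
    (B : Matrix (Fin n) (Fin n) ℤ) (hB : SNF.IsSNF N B)
    (hinv : ¬ (N : ℤ) ∣ 1 + ∑ j ∈ Finset.univ.erase (0 : Fin n), B 0 j ^ 2)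
    (ε : ℝ) (hε0 : 0 < ε) (hε1 : ε < 1)
    (s : ℝ) (hs : 0 < s) (hsη : SNF.smoothingParameter (SNF.toReal B) ε ≤ s)
    (c : SNF.E n) :
    (∀ x : Fin n → ZMod N,
      (SNF.phi3 B x ∈ SNF.NLdualN N B ∧ x + SNF.phi3 B x ∈ SNF.LN N B) ∧
      ∀ y ∈ SNF.NLdualN N B, x + y ∈ SNF.LN N B → y = SNF.phi3 B x) ∧
    SNF.statDist ((SNF.discreteGaussianMod N s hs c).map (SNF.phi3 B))
      (SNF.uniformNLdualN N B) ≤ ε := by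
  refine ⟨fun x => ⟨SNF.phi3_spec hB hinv x, fun y hy hxy => ?_⟩,
    SNF.statDist_map_phi3_le hB hinv hε0 hε1 hs hsη c⟩
  rw [SNF.mem_LN_iff hB, SNF.congruenceForm_add] at hxy
  exact (SNF.eq_phi3_iff hB hinv hy).2 hxy
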